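/- Let $\Sigma$ be an alphabet and let $w=a_1\cdots a_n\in\Sigma^*$ be a word of length $n\ge 2$ with pairwise distinct letters. Let $w_1,w_2$ be non-empty suffixes of $w$ (possibly $w$ itself), let $k\ge l\ge 0$ be integers, and put $u=w_1w^k$ and $v=w_2w^l$. Let $$u \mathbin{\sqcup\mkern-3mu\sqcup} v=\{u_1v_1\cdots u_rv_r \mid u=u_1\cdots u_r,\ v=v_1\cdots v_r,\ u_i,v_i\in\Sigma^*\}$$ be the shuffle of $u$ and $v$. DFAs are not required to be complete (the transition function may be partial), and the minimal DFA of a language is the one with the fewest states among the DFAs accepting it. 1. If $k>l$, then the minimal DFA for $u \mathbin{\sqcup\mkern-3mu\sqcup} v$ has exactly $$(|u|+1)(|v|+1)-\tfrac12|v|(|v|+1)-\tfrac12 m(m+1)$$ states, where $m$ is the largest integer with $0\le m\le |v|$ and $(|u|-m)\bmod n=0$; if there is no such $m$, the term $\tfrac12 m(m+1)$ is to be omitted. 2. If $k=l$ and $|w_1|\ge|w_2|$, then the minimal DFA for $u \mathbin{\sqcup\mkern-3mu\sqcup} v$ has exactly $$(|u|+1)(|v|+1)-\tfrac12|v|(|v|+1)-\tfrac12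 d(d+1)$$ states, where $d=\max(|u|-|w|,0)$. -/

import Mathlib

/-- The shuffle `u ⧢ v`: all words `u₁ v₁ u₂ v₂ ⋯ uₙ vₙ` where `u = u₁ ⋯ uₙ` and `v = v₁ ⋯ vₙ`
for some `n` and some (possibly empty) words `uᵢ`, `vᵢ`. -/
def wordShuffle {α : Type*} (u v : List α) : Language α :=
  {x | ∃ us vs : List (List α), us.length = vs.length ∧ us.flatten = u ∧ vs.flatten = v ∧
    x = (List.zipWith (fun p q => p ++ q) us vs).flatten}

/-- The power `w ^ k` of a word. -/
def wordPow {α : Type*} (w : List α) (k : ℕ) : List α :=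
  (List.replicate k w).flatten

/-- A deterministic finite automaton whose transition function may be partial: `step s a = none`
means that there is no transition from `s` labelled `a`. -/
structure PartialDFA (α : Type*) (σ : Type*) where
  /-- The partial transition function. -/
  step : σ → α → Option σ
  /-- The initial state. -/
  start : σ
  /-- The set of final states. -/
  accept : Set σ

namespace PartialDFA

/-- The state reached from `s` by reading a word, if there is one. -/
def run {α σ : Type*} (M : PartialDFA α σ) : σ → List α → Option σ
  | s, [] => some s
  | s, a :: x => (M.step s a).bind fun t => run M t x

/-- The language accepted by the automaton. -/
def accepts {α σ : Type*} (M : PartialDFA α σ) : Language α :=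
  {x | ∃ t ∈ M.accept, M.run M.start x = some t}

end PartialDFA

/-- The minimal (not necessarily complete) DFA for the language `L` has exactly `N` states:
some DFA with `N` states accepts `L`, and no DFA with fewer states does. -/
def MinimalDFASize {α : Type*} (L : Language α) (N : ℕ) : Prop :=
  IsLeast {q : ℕ | ∃ M : PartialDFA α (Fin q), M.accepts = L} N

/-! Both `u` and `v` are suffixes of the left-infinite periodic word `⋯www`. Write `s_a` for its suffix
of length `a` and `n` for the length of `w`. After reading some letters of `u ⧢ v`, what remains is a
union of shuffles `s_a ⧢ s_b`, and these depend only on the unordered pair `{a, b}`; so take `b ≤ a`.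

A choice between the two factors arises only when `n ∣ a - b`. Then for `b < a` the remainder
`s_a ⧢ s_(b-1)` is contained in `s_(a-1) ⧢ s_b` (`suffixShuffle_subset`: run the second shuffle as a
mirror image of the first until the two pairs of remaining lengths coincide). Hence every non-empty
left quotient of `u ⧢ v` is a single `s_a ⧢ s_b`, and the pairs `b ≤ a` form a deterministic
automaton `pairDFA`, in which decreasing `b` is impossible when `n ∣ a - b` and `b < a`.

Distinct pairs have distinct languages (`suffixShuffle_injective`): the word that follows `s_a` down to
length `b` and then doubles every letter of `s_b` lies in `s_a ⧢ s_b`, but in no `s_c ⧢ s_d` with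
`c < b` or `d < b`, since a doubled letter must be taken from both factors.

The multiples of `n` are barriers for the difference `a - b`, except for `0`, which is left by exchanging
the factors. So the pairs reachable from `(|u|, |v|)` are those with `b ≤ a ≤ |u|`, `b ≤ |v|` and
`a - b ≤ D`, where `D` is the least positive multiple of `n` with `|u| - |v| ≤ D`
(`pairDFA_reachable_iff`). A reachable automaton without dead or equivalent states is minimal
(`PartialDFA.minimalDFASize_of_reduced`), and counting these pairs gives the formulas. -/

/-! ### Minimality of reduced partial automata -/

namespace PartialDFA

variable {α σ : Type*}

theorem run_append (M : PartialDFA α σ) (s : σ) (x y : List α) :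
    M.run s (x ++ y) = (M.run s x).bind fun t => M.run t y := by
  induction x generalizing s with
  | nil => rfl
  | cons a x ih =>
    simp only [List.cons_append, run, Option.bind_assoc]
    congr 1
    funext t
    exact ih t

/-- The right language of a state: the words leading from it to a final state. -/
def acceptsFrom (M : PartialDFA α σ) (s : σ) : Language α :=
  {x | ∃ t ∈ M.accept, M.run s x = some t}

theorem cons_mem_acceptsFrom (M : PartialDFA α σ) (s : σ) (a : α) (x : List α) :
    a :: x ∈ M.acceptsFrom s ↔ ∃ t, M.step s a = some t ∧ x ∈ M.acceptsFrom t := by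
  change (∃ t ∈ M.accept, (M.step s a).bind (fun t => M.run t x) = some t) ↔
    ∃ t, M.step s a = some t ∧ ∃ r ∈ M.accept, M.run t x = some r
  simp only [Option.bind_eq_some_iff]
  tauto

theorem append_mem_acceptsFrom (M : PartialDFA α σ) (s : σ) (x y : List α) :
    x ++ y ∈ M.acceptsFrom s ↔ ∃ t, M.run s x = some t ∧ y ∈ M.acceptsFrom t := by
  change (∃ t ∈ M.accept, M.run s (x ++ y) = some t) ↔
    ∃ t, M.run s x = some t ∧ ∃ r ∈ M.accept, M.run t y = some r
  simp only [run_append, Option.bind_eq_some_iff]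
  tauto

open Classical in
/-- The restriction of an automaton to a finite set `R` of states, carried over to `Fin R.card`;
transitions leaving `R` are dropped. -/
noncomputable def restrict (M : PartialDFA α σ) (R : Finset σ) (s₀ : R) :
    PartialDFA α (Fin R.card) where
  step i a := (M.step (R.equivFin.symm i) a).bind fun t =>
    if h : t ∈ R then some (R.equivFin ⟨t, h⟩) else none
  start := R.equivFin s₀
  accept := {i | (R.equivFin.symm i : σ) ∈ M.accept}

theorem acceptsFrom_restrict (M : PartialDFA α σ) (R : Finset σ) (s₀ : R)
    (hR : ∀ s ∈ R, ∀ a, ∀ t, M.step s a = some t → t ∈ R) (s : R) :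
    (M.restrict R s₀).acceptsFrom (R.equivFin s) = M.acceptsFrom s := by
  ext x
  induction x generalizing s with
  | nil =>
    change (∃ i, (R.equivFin.symm i : σ) ∈ M.accept ∧ some (R.equivFin s) = some i) ↔
      ∃ t ∈ M.accept, some (s : σ) = some t
    simp
  | cons a x ih =>
    rw [cons_mem_acceptsFrom, cons_mem_acceptsFrom]
    constructor
    · rintro ⟨i, hi, hx⟩
      simp only [restrict, Equiv.symm_apply_apply, Option.bind_eq_some_iff] at hi
      obtain ⟨t, ht, hti⟩ := hi
      have htR := hR s s.2 a t ht
      rw [dif_pos htR, Option.some_inj] at hti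
      subst hti
      exact ⟨t, ht, (ih ⟨t, htR⟩).1 hx⟩
    · rintro ⟨t, ht, hx⟩
      have htR := hR s s.2 a t ht
      refine ⟨R.equivFin ⟨t, htR⟩, ?_, (ih ⟨t, htR⟩).2 hx⟩
      simp [restrict, ht, htR]

/-- If the reachable states of an automaton form a finite set, none of them is dead, and no two of
them have the same right language, then their number is the size of the minimal automaton. -/
theorem minimalDFASize_of_reduced (M : PartialDFA α σ) (R : Finset σ)
    (hR : ∀ s, s ∈ R ↔ ∃ x, M.run M.start x = some s)
    (hne : ∀ s ∈ R, ∃ x, x ∈ M.acceptsFrom s)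
    (hinj : ∀ s ∈ R, ∀ t ∈ R, M.acceptsFrom s = M.acceptsFrom t → s = t) :
    MinimalDFASize M.accepts R.card := by
  have hstart : M.start ∈ R := (hR _).2 ⟨[], rfl⟩
  constructor
  · refine ⟨M.restrict R ⟨M.start, hstart⟩, ?_⟩
    refine acceptsFrom_restrict M R ⟨M.start, hstart⟩ ?_ ⟨M.start, hstart⟩
    intro s hs a t ht
    obtain ⟨x, hx⟩ := (hR s).1 hs
    refine (hR t).2 ⟨x ++ [a], ?_⟩
    simp [run_append, hx, run, ht]
  · rintro q ⟨M', hM'⟩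
    have key : ∀ s : R, ∃ i : Fin q, M'.acceptsFrom i = M.acceptsFrom s := by
      rintro ⟨s, hs⟩
      obtain ⟨x, hx⟩ := (hR s).1 hs
      have hq : ∀ y, x ++ y ∈ M'.acceptsFrom M'.start ↔ y ∈ M.acceptsFrom s := by
        intro y
        have : x ++ y ∈ M'.acceptsFrom M'.start ↔ x ++ y ∈ M.acceptsFrom M.start :=
          Set.ext_iff.1 hM' (x ++ y)
        rw [this, append_mem_acceptsFrom]
        simp [hx]
      obtain ⟨y, hy⟩ := hne s hs
      obtain ⟨i, hi, -⟩ := (append_mem_acceptsFrom ..).1 ((hq y).2 hy)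
      refine ⟨i, ?_⟩
      ext z
      rw [← hq z, append_mem_acceptsFrom]
      simp [hi]
    choose f hf using key
    have hfinj : Function.Injective f := fun s t hst =>
      Subtype.ext (hinj s s.2 t t.2 (by rw [← hf s, ← hf t, hst]))
    simpa using Fintype.card_le_of_injective f hfinj

end PartialDFA

/-! ### Shuffles -/

section Shuffle

variable {α : Type*}

theorem wordShuffle_comm (u v : List α) : wordShuffle u v = wordShuffle v u := by
  suffices h : ∀ u v : List α, ∀ x, x ∈ wordShuffle u v → x ∈ wordShuffle v u from
    Set.ext fun x => ⟨h u v x, h v u x⟩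
  rintro u v x ⟨us, vs, hl, rfl, rfl, rfl⟩
  -- Empty blocks at the two ends shift the roles of the factors.
  refine ⟨[] :: vs, us ++ [[]], by simp [hl], by simp, by simp, ?_⟩
  suffices h : ∀ (us vs : List (List α)) (p : List α), us.length = vs.length →
      p ++ (List.zipWith (fun p q => p ++ q) us vs).flatten =
        (List.zipWith (fun p q => p ++ q) (p :: vs) (us ++ [[]])).flatten by
    simpa using h us vs [] hl
  intro us
  induction us with
  | nil => intro vs p h; cases vs <;> simp_all
  | cons a us ih =>
    intro vs p h
    cases vs with
    | nil => simp at h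
    | cons b vs =>
      have := ih vs b (by simpa using h)
      simp [← this]

theorem nil_mem_wordShuffle (u v : List α) : [] ∈ wordShuffle u v ↔ u = [] ∧ v = [] := by
  constructor
  · rintro ⟨us, vs, hl, rfl, rfl, h⟩
    induction us generalizing vs with
    | nil => cases vs <;> simp_all
    | cons p us ih =>
      cases vs with
      | nil => simp at hl
      | cons q vs =>
        have h' : (p = [] ∧ q = []) ∧ [] = (List.zipWith (fun p q => p ++ q) us vs).flatten := by
          rw [List.zipWith_cons_cons, List.flatten_cons] at h
          have h₁ := List.append_eq_nil_iff.1 h.symm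
          exact ⟨List.append_eq_nil_iff.1 h₁.1, h₁.2.symm⟩
        obtain ⟨⟨rfl, rfl⟩, h'⟩ := h'
        simpa using ih vs (by simpa using hl) h'
  · rintro ⟨rfl, rfl⟩
    exact ⟨[], [], rfl, rfl, rfl, rfl⟩

theorem cons_mem_wordShuffle_cons {c : α} {x u v : List α} (h : x ∈ wordShuffle u v) :
    c :: x ∈ wordShuffle (c :: u) v := by
  obtain ⟨us, vs, hl, rfl, rfl, rfl⟩ := h
  exact ⟨[c] :: us, [] :: vs, by simp [hl], by simp, by simp, by simp⟩

theorem cons_mem_wordShuffle (c : α) (x u v : List α) : c :: x ∈ wordShuffle u v ↔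
    (∃ u', u = c :: u' ∧ x ∈ wordShuffle u' v) ∨ ∃ v', v = c :: v' ∧ x ∈ wordShuffle u v' := by
  constructor
  · rintro ⟨us, vs, hl, rfl, rfl, h⟩
    induction us generalizing vs with
    | nil => simp at h
    | cons p us ih =>
      cases vs with
      | nil => simp at hl
      | cons q vs =>
        have hl' : us.length = vs.length := by simpa using hl
        cases p with
        | cons a p =>
          simp only [List.zipWith_cons_cons, List.flatten_cons, List.cons_append,
            List.cons.injEq] at h
          obtain ⟨rfl, rfl⟩ := h
          exact .inl ⟨p ++ us.flatten, by simp, p :: us, q :: vs, by simp [hl'], by simp, by simp,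
            by simp⟩
        | nil =>
          cases q with
          | cons b q =>
            simp only [List.zipWith_cons_cons, List.flatten_cons, List.cons_append,
              List.nil_append, List.cons.injEq] at h
            obtain ⟨rfl, rfl⟩ := h
            exact .inr ⟨q ++ vs.flatten, by simp, [] :: us, q :: vs, by simp [hl'], by simp,
              by simp, by simp⟩
          | nil => simpa using ih vs hl' (by simpa using h)
  · rintro (⟨u', rfl, h⟩ | ⟨v', rfl, h⟩)
    · exact cons_mem_wordShuffle_cons h
    · rw [wordShuffle_comm] at h ⊢
      exact cons_mem_wordShuffle_cons h

end Shuffle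

/-! ### Shuffles of suffixes of a periodic word -/

section Suffix

variable {α : Type*}

/-- The suffix of length `a` of the left-infinite word `⋯ (g 2) (g 1) (g 0)`. -/
def leftSuffix (g : ℕ → α) : ℕ → List α
  | 0 => []
  | a + 1 => g a :: leftSuffix g a

theorem length_leftSuffix (g : ℕ → α) (a : ℕ) : (leftSuffix g a).length = a := by
  induction a with
  | zero => rfl
  | succ a ih => simp [leftSuffix, ih]

/-- The shuffle of the suffixes of lengths `a` and `b` of `⋯ (g 2) (g 1) (g 0)`. -/
def suffixShuffle (g : ℕ → α) (a b : ℕ) : Language α :=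
  wordShuffle (leftSuffix g a) (leftSuffix g b)

theorem suffixShuffle_comm (g : ℕ → α) (a b : ℕ) : suffixShuffle g a b = suffixShuffle g b a :=
  wordShuffle_comm _ _

theorem leftSuffix_eq_cons {g : ℕ → α} {a : ℕ} {c : α} {u : List α} :
    leftSuffix g a = c :: u ↔ ∃ a', a = a' + 1 ∧ c = g a' ∧ u = leftSuffix g a' := by
  cases a with
  | zero => simp [leftSuffix]
  | succ a => simp [leftSuffix, eq_comm]

theorem nil_mem_suffixShuffle (g : ℕ → α) (a b : ℕ) :
    [] ∈ suffixShuffle g a b ↔ a = 0 ∧ b = 0 := by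
  rw [suffixShuffle, nil_mem_wordShuffle, ← List.length_eq_zero_iff, ← List.length_eq_zero_iff,
    length_leftSuffix, length_leftSuffix]

theorem cons_mem_suffixShuffle (g : ℕ → α) (c : α) (x : List α) (a b : ℕ) :
    c :: x ∈ suffixShuffle g a b ↔
      (∃ a', a = a' + 1 ∧ c = g a' ∧ x ∈ suffixShuffle g a' b) ∨
        ∃ b', b = b' + 1 ∧ c = g b' ∧ x ∈ suffixShuffle g a b' := by
  rw [suffixShuffle, cons_mem_wordShuffle]
  simp only [leftSuffix_eq_cons]
  refine or_congr ⟨?_, ?_⟩ ⟨?_, ?_⟩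
  · rintro ⟨_, ⟨a', h, h', rfl⟩, hx⟩
    exact ⟨a', h, h', hx⟩
  · rintro ⟨a', h, h', hx⟩
    exact ⟨_, ⟨a', h, h', rfl⟩, hx⟩
  · rintro ⟨_, ⟨a', h, h', rfl⟩, hx⟩
    exact ⟨a', h, h', hx⟩
  · rintro ⟨a', h, h', hx⟩
    exact ⟨_, ⟨a', h, h', rfl⟩, hx⟩

theorem length_of_mem_suffixShuffle {g : ℕ → α} {x : List α} {a b : ℕ}
    (h : x ∈ suffixShuffle g a b) : x.length = a + b := by
  induction x generalizing a b with
  | nil => simp [(nil_mem_suffixShuffle g a b).1 h]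
  | cons c x ih =>
    obtain ⟨a', rfl, -, h⟩ | ⟨b', rfl, -, h⟩ := (cons_mem_suffixShuffle g c x a b).1 h
    · rw [List.length_cons, ih h]; omega
    · rw [List.length_cons, ih h]; omega

/-- Reflecting the pair of lengths `(a + e, b)`, whose difference is at least `e`, in the line of
difference `e` enlarges the shuffle, if `e` is a period of `g`. The mirror image of a path of
remaining lengths reads the same letters, and the path has to cross the line. -/
theorem suffixShuffle_subset {g : ℕ → α} {e : ℕ} (hg : ∀ i, g (i + e) = g i) {x : List α} {a b : ℕ}
    (hba : b ≤ a) (h : x ∈ suffixShuffle g (a + e) b) : x ∈ suffixShuffle g (b + e) a := by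
  induction x generalizing a b with
  | nil =>
    rw [nil_mem_suffixShuffle] at h ⊢
    omega
  | cons c x ih =>
    obtain rfl | hlt := hba.eq_or_lt
    · exact h
    rw [cons_mem_suffixShuffle] at h ⊢
    obtain ⟨a', ha', rfl, h⟩ | ⟨b', rfl, rfl, h⟩ := h
    · obtain ⟨a, rfl⟩ : ∃ a₀, a = a₀ + 1 := ⟨a - 1, by omega⟩
      obtain rfl : a' = a + e := by omega
      exact .inr ⟨a, rfl, hg a, ih (by omega) h⟩
    · exact .inl ⟨b' + e, by omega, (hg b').symm, ih (by omega) h⟩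

/-- The word `(g (b+d-1)) ⋯ (g b)` followed by `(g (b-1))² ⋯ (g 0)²`. -/
def doubledSuffix (g : ℕ → α) : ℕ → ℕ → List α
  | b, d + 1 => g (b + d) :: doubledSuffix g b d
  | 0, 0 => []
  | b + 1, 0 => g b :: g b :: doubledSuffix g b 0

theorem doubledSuffix_succ (g : ℕ → α) (b d : ℕ) :
    doubledSuffix g b (d + 1) = g (b + d) :: doubledSuffix g b d := by
  rw [doubledSuffix]

theorem doubledSuffix_mem (g : ℕ → α) (b d : ℕ) :
    doubledSuffix g b d ∈ suffixShuffle g (b + d) b := by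
  induction d with
  | zero =>
    induction b with
    | zero =>
      rw [doubledSuffix]
      exact (nil_mem_suffixShuffle g 0 0).2 ⟨rfl, rfl⟩
    | succ b ih =>
      rw [doubledSuffix]
      refine (cons_mem_suffixShuffle ..).2 (.inl ⟨b, rfl, rfl, ?_⟩)
      exact (cons_mem_suffixShuffle ..).2 (.inr ⟨b, rfl, rfl, ih⟩)
  | succ d ih =>
    rw [doubledSuffix_succ]
    exact (cons_mem_suffixShuffle ..).2 (.inl ⟨b + d, rfl, rfl, ih⟩)

/-- As neighbouring letters of `g` differ, a doubled letter has to be taken from both factors. -/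
theorem le_of_doubledSuffix_mem {g : ℕ → α} (hg : ∀ i, g (i + 1) ≠ g i) {b d p q : ℕ}
    (h : doubledSuffix g b d ∈ suffixShuffle g p q) : b ≤ p ∧ b ≤ q := by
  induction d generalizing p q with
  | zero =>
    induction b generalizing p q with
    | zero => exact ⟨p.zero_le, q.zero_le⟩
    | succ b ih =>
      rw [doubledSuffix, cons_mem_suffixShuffle] at h
      obtain ⟨p, rfl, hp, h⟩ | ⟨q, rfl, hq, h⟩ := h <;> rw [cons_mem_suffixShuffle] at h <;>
        obtain ⟨p', rfl, hp', h⟩ | ⟨q', rfl, hq', h⟩ := h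
      · exact absurd (hp.symm.trans hp') (hg p')
      · have := ih h; omega
      · have := ih h; omega
      · exact absurd (hq.symm.trans hq') (hg q')
  | succ d ih =>
    rw [doubledSuffix_succ, cons_mem_suffixShuffle] at h
    obtain ⟨p, rfl, hp, h⟩ | ⟨q, rfl, hq, h⟩ := h
    · have := ih h; omega
    · have := ih h; omega

theorem exists_mem_suffixShuffle (g : ℕ → α) {a b : ℕ} (h : b ≤ a) :
    ∃ x, x ∈ suffixShuffle g a b := by
  obtain ⟨d, rfl⟩ := Nat.exists_eq_add_of_le h
  exact ⟨_, doubledSuffix_mem g b d⟩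

theorem suffixShuffle_injective {g : ℕ → α} (hg : ∀ i, g (i + 1) ≠ g i) {a b a' b' : ℕ}
    (hba : b ≤ a) (hba' : b' ≤ a') (h : suffixShuffle g a b = suffixShuffle g a' b') :
    a = a' ∧ b = b' := by
  obtain ⟨d, rfl⟩ := Nat.exists_eq_add_of_le hba
  obtain ⟨d', rfl⟩ := Nat.exists_eq_add_of_le hba'
  have h₁ := doubledSuffix_mem g b d
  have h₂ := doubledSuffix_mem g b' d'
  have hl := length_of_mem_suffixShuffle h₁
  rw [h] at h₁
  rw [← h] at h₂
  have hl' := length_of_mem_suffixShuffle h₁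
  have := le_of_doubledSuffix_mem hg h₁
  have := le_of_doubledSuffix_mem hg h₂
  omega

end Suffix

/-! ### The automaton of pairs of remaining lengths -/

section PairDFA

variable {α : Type*}

open Classical in
/-- The automaton whose state `(a, b)`, for `b ≤ a`, stands for the quotient `suffixShuffle g a b`.
It takes the letter from the longer factor if possible; from `(a, a)` with `a` positive it goes to
`(a, a - 1)`, which keeps the longer factor first. -/
noncomputable def pairDFA (g : ℕ → α) (U V : ℕ) : PartialDFA α (ℕ × ℕ) where
  step s c :=
    if s.2 < s.1 ∧ c = g (s.1 - 1) then some (s.1 - 1, s.2)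
    else if 0 < s.2 ∧ c = g (s.2 - 1) then some (s.1, s.2 - 1)
    else none
  start := (U, V)
  accept := {(0, 0)}

variable {g : ℕ → α} {n : ℕ}

open Classical in
theorem pairDFA_step (g : ℕ → α) (U V a b : ℕ) (c : α) : (pairDFA g U V).step (a, b) c =
    if b < a ∧ c = g (a - 1) then some (a - 1, b)
    else if 0 < b ∧ c = g (b - 1) then some (a, b - 1)
    else none := rfl

theorem acceptsFrom_pairDFA (hg : ∀ i j, g i = g j ↔ i ≡ j [MOD n]) (U V : ℕ) {a b : ℕ}
    (hba : b ≤ a) : (pairDFA g U V).acceptsFrom (a, b) = suffixShuffle g a b := by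
  ext x
  induction x generalizing a b with
  | nil =>
    rw [nil_mem_suffixShuffle]
    change (∃ t ∈ ({(0, 0)} : Set (ℕ × ℕ)), some (a, b) = some t) ↔ _
    simp
  | cons c x ih =>
    rw [PartialDFA.cons_mem_acceptsFrom, cons_mem_suffixShuffle]
    rw [pairDFA_step]
    split_ifs with h₁ h₂
    · obtain ⟨hlt, hc⟩ := h₁
      obtain ⟨a, rfl⟩ : ∃ a₀, a = a₀ + 1 := ⟨a - 1, by omega⟩
      simp only [Nat.add_sub_cancel, Option.some_inj, exists_eq_left'] at hc ⊢
      rw [ih (by omega)]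
      refine ⟨fun h => .inl ⟨a, rfl, hc, h⟩, ?_⟩
      rintro (⟨a', ha', -, h⟩ | ⟨b', rfl, hc', h⟩)
      · obtain rfl : a = a' := by omega
        exact h
      · obtain ⟨e, rfl⟩ := Nat.exists_eq_add_of_le (show b' ≤ a by omega)
        have he : e ≡ 0 [MOD n] := by
          have := (hg _ _).1 (hc.symm.trans hc')
          exact Nat.ModEq.add_left_cancel' b' this
        have hper : ∀ i, g (i + e) = g i := fun i => (hg _ _).2 (by simpa using he.add_left i)
        exact suffixShuffle_subset hper (Nat.le_succ b') (by rwa [Nat.add_right_comm])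
    · obtain ⟨hpos, hc⟩ := h₂
      obtain ⟨b, rfl⟩ : ∃ b₀, b = b₀ + 1 := ⟨b - 1, by omega⟩
      simp only [Nat.add_sub_cancel, Option.some_inj, exists_eq_left'] at hc ⊢
      rw [ih (by omega)]
      refine ⟨fun h => .inr ⟨b, rfl, hc, h⟩, ?_⟩
      rintro (⟨a', rfl, hc', h⟩ | ⟨b', hb', -, h⟩)
      · obtain rfl : a' = b := by
          by_contra hne
          exact h₁ ⟨by omega, by simpa using hc'⟩
        rwa [suffixShuffle_comm]
      · obtain rfl : b = b' := by omega
        exact h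
    · simp only [false_and, exists_false, false_iff]
      rintro (⟨a', rfl, hc', h⟩ | ⟨b', rfl, hc', h⟩)
      · obtain hlt | heq := hba.lt_or_eq
        · exact h₁ ⟨hlt, by simpa using hc'⟩
        · subst heq
          exact h₂ ⟨by simp, by simpa using hc'⟩
      · exact h₂ ⟨by simp, by simpa using hc'⟩

/-- The pairs `(a, b)` with `b ≤ a ≤ U`, `b ≤ V` and `a - b ≤ D`. -/
def pairStates (U V D : ℕ) : Finset (ℕ × ℕ) :=
  (Finset.range (U + 1) ×ˢ Finset.range (V + 1)).filter fun s => s.2 ≤ s.1 ∧ s.1 ≤ s.2 + D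

theorem mem_pairStates {U V D a b : ℕ} :
    (a, b) ∈ pairStates U V D ↔ a ≤ U ∧ b ≤ V ∧ b ≤ a ∧ a ≤ b + D := by
  simp [pairStates, and_assoc]

/-- The difference cannot pass a positive multiple `D` of the period. -/
theorem pairDFA_step_mem (hg : ∀ i j, g i = g j ↔ i ≡ j [MOD n]) {U V D : ℕ} (hD : 0 < D)
    (hnD : n ∣ D) {s t : ℕ × ℕ} {c : α} (hs : s ∈ pairStates U V D)
    (h : (pairDFA g U V).step s c = some t) : t ∈ pairStates U V D := by
  obtain ⟨a, b⟩ := s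
  rw [mem_pairStates] at hs
  rw [pairDFA_step] at h
  split_ifs at h with h₁ h₂
  · obtain rfl := Option.some_inj.1 h
    rw [mem_pairStates]
    omega
  · obtain rfl := Option.some_inj.1 h
    rw [mem_pairStates]
    refine ⟨hs.1, by omega, by omega, ?_⟩
    by_contra hlt
    obtain rfl : a = b + D := by omega
    refine h₁ ⟨by omega, h₂.2.trans ((hg _ _).2 ?_)⟩
    rw [show b + D - 1 = b - 1 + D by omega]
    simpa using (Nat.modEq_zero_iff_dvd.2 hnD).symm.add_left (b - 1)

theorem pairDFA_reachable (hg : ∀ i j, g i = g j ↔ i ≡ j [MOD n]) (hn : 2 ≤ n) {U V D : ℕ}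
    (hVU : V ≤ U) (hD : IsLeast {d | 0 < d ∧ n ∣ d ∧ U ≤ V + d} D) (N : ℕ) {a b : ℕ}
    (hN : U + V = a + b + N) (h : (a, b) ∈ pairStates U V D) :
    ∃ x, (pairDFA g U V).run (pairDFA g U V).start x = some (a, b) := by
  obtain ⟨⟨hDpos, hnD, hUVD⟩, hmin⟩ := hD
  induction N generalizing a b with
  | zero =>
    rw [mem_pairStates] at h
    obtain rfl : a = U := by omega
    obtain rfl : b = V := by omega
    exact ⟨[], rfl⟩
  | succ N ih =>
    have extend : ∀ {s : ℕ × ℕ} {c : α},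
        (∃ x, (pairDFA g U V).run (pairDFA g U V).start x = some s) →
        (pairDFA g U V).step s c = some (a, b) →
        ∃ x, (pairDFA g U V).run (pairDFA g U V).start x = some (a, b) := by
      rintro s c ⟨x, hx⟩ hs
      exact ⟨x ++ [c], by simp [PartialDFA.run_append, hx, PartialDFA.run, hs]⟩
    rw [mem_pairStates] at h
    by_cases ha : a < U ∧ a < b + D
    · refine extend (c := g a) (ih (a := a + 1) (b := b) (by omega) ?_) ?_
      · rw [mem_pairStates]; omega
      · rw [pairDFA_step]
        rw [if_pos ⟨by omega, by simp⟩]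
        simp
    · -- Either `a = U`, or the difference is `D`; in both cases the last letter came from `s_b`.
      have hbV : b < V := by omega
      obtain rfl | hlt : a = b ∨ b + 1 ≤ a := by omega
      · omega
      refine extend (c := g b) (ih (a := a) (b := b + 1) (by omega) ?_) ?_
      · rw [mem_pairStates]; omega
      · rw [pairDFA_step]
        rw [if_neg, if_pos ⟨by omega, by simp⟩]
        · simp
        · rintro ⟨hlt', hc⟩
          have hmod : b ≡ a - 1 [MOD n] := (hg _ _).1 hc
          have hdvd : n ∣ a - 1 - b := (Nat.modEq_iff_dvd' (by omega)).1 hmod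
          have hlt'' : a - 1 - b < D := by omega
          by_cases haU : a = U
          · have := hmin ⟨by omega, hdvd, by omega⟩
            omega
          · -- Here `n` divides both `D` and `D - 1`.
            have hD1 : a - 1 - b = D - 1 := by omega
            rw [hD1] at hdvd
            have h1 : n ∣ 1 := by
              have := Nat.dvd_sub hnD hdvd
              rwa [show D - (D - 1) = 1 by omega] at this
            have := Nat.le_of_dvd one_pos h1
            omega

theorem pairDFA_reachable_iff (hg : ∀ i j, g i = g j ↔ i ≡ j [MOD n]) (hn : 2 ≤ n) {U V D : ℕ}
    (hVU : V ≤ U) (hD : IsLeast {d | 0 < d ∧ n ∣ d ∧ U ≤ V + d} D) (s : ℕ × ℕ) :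
    s ∈ pairStates U V D ↔ ∃ x, (pairDFA g U V).run (pairDFA g U V).start x = some s := by
  constructor
  · intro h
    have h' := mem_pairStates.1 h
    exact pairDFA_reachable hg hn hVU hD (U + V - (s.1 + s.2)) (by omega) h
  · rintro ⟨x, hx⟩
    have hstart : (U, V) ∈ pairStates U V D := mem_pairStates.2 ⟨le_rfl, le_rfl, hVU, hD.1.2.2⟩
    change (pairDFA g U V).run (U, V) x = some s at hx
    generalize (U, V) = t at hx hstart
    induction x generalizing t with
    | nil =>
      obtain rfl := Option.some_inj.1 hx
      exact hstart
    | cons c x ih =>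
      obtain ⟨r, hr, hx⟩ := Option.bind_eq_some_iff.1 hx
      exact ih r hx (pairDFA_step_mem hg hD.1.1 hD.1.2.1 hstart hr)

theorem card_pairStates {U V D : ℕ} (hVU : V ≤ U) (hUVD : U ≤ V + D) :
    ((pairStates U V D).card : ℚ) = (U + 1) * (V + 1) - 1 / 2 * V * (V + 1)
      - 1 / 2 * (U - D : ℕ) * ((U - D : ℕ) + 1) := by
  have hfib : ∀ b ∈ Finset.range (V + 1),
      ((Finset.range (U + 1)).filter fun a => b ≤ a ∧ a ≤ b + D).card + b + (U - D - b)
        = U + 1 := by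
    intro b hb
    have hb' := Finset.mem_range.1 hb
    have : ((Finset.range (U + 1)).filter fun a => b ≤ a ∧ a ≤ b + D)
        = Finset.Icc b (min U (b + D)) := by
      ext a
      simp only [Finset.mem_filter, Finset.mem_range, Finset.mem_Icc]
      omega
    rw [this, Nat.card_Icc]
    omega
  have hcard : (pairStates U V D).card = ∑ b ∈ Finset.range (V + 1),
      ((Finset.range (U + 1)).filter fun a => b ≤ a ∧ a ≤ b + D).card := by
    simp only [pairStates, Finset.card_filter, Finset.sum_product_right]
  have hsum := Finset.sum_congr rfl hfib
  rw [Finset.sum_add_distrib, Finset.sum_add_distrib, ← hcard] at hsum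
  have gauss : ∀ k : ℕ, (∑ b ∈ Finset.range (k + 1), (b : ℚ)) = 1 / 2 * k * (k + 1) := by
    intro k
    induction k with
    | zero => simp
    | succ k ih => rw [Finset.sum_range_succ, ih]; push_cast; ring
  have htri : ∑ b ∈ Finset.range (V + 1), (U - D - b)
      = ∑ b ∈ Finset.range (U - D + 1), b := by
    rw [← Finset.sum_range_reflect (fun b => b)]
    refine (Finset.sum_subset_zero_on_sdiff ?_ ?_ ?_).symm
    · exact Finset.range_subset_range.2 (by omega)
    · intro b hb
      simp only [Finset.mem_sdiff, Finset.mem_range] at hb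
      omega
    · intro b hb
      omega
  rw [htri] at hsum
  have hQ := congrArg (fun k : ℕ => (k : ℚ)) hsum
  simp only [Nat.cast_add, Nat.cast_sum, gauss, Finset.sum_const, Finset.card_range,
    nsmul_eq_mul, Nat.cast_mul, Nat.cast_one] at hQ
  linear_combination hQ

theorem minimalDFASize_suffixShuffle (hg : ∀ i j, g i = g j ↔ i ≡ j [MOD n]) (hn : 2 ≤ n)
    {U V D : ℕ} (hVU : V ≤ U) (hD : IsLeast {d | 0 < d ∧ n ∣ d ∧ U ≤ V + d} D) :
    MinimalDFASize (suffixShuffle g U V) (pairStates U V D).card := by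
  have hg' : ∀ i, g (i + 1) ≠ g i := by
    intro i h
    have : 1 ≡ 0 [MOD n] := Nat.ModEq.add_left_cancel' i ((hg _ _).1 h)
    have := Nat.le_of_dvd one_pos (Nat.modEq_zero_iff_dvd.1 this)
    omega
  rw [← acceptsFrom_pairDFA hg U V hVU]
  refine (pairDFA g U V).minimalDFASize_of_reduced _ (pairDFA_reachable_iff hg hn hVU hD) ?_ ?_
  · rintro ⟨a, b⟩ hs
    have hba := (mem_pairStates.1 hs).2.2.1
    rw [acceptsFrom_pairDFA hg U V hba]
    exact exists_mem_suffixShuffle g hba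
  · rintro ⟨a, b⟩ hs ⟨a', b'⟩ ht h
    have hba := (mem_pairStates.1 hs).2.2.1
    have hba' := (mem_pairStates.1 ht).2.2.1
    rw [acceptsFrom_pairDFA hg U V hba, acceptsFrom_pairDFA hg U V hba'] at h
    exact Prod.ext_iff.2 (suffixShuffle_injective hg' hba hba' h)

end PairDFA

/-! ### The periodic word with period `w` -/

section Periodic

variable {α : Type*} {w : List α}

/-- The letter of `⋯www` that is followed by exactly `i` letters. -/
def periodicLetter (w : List α) (hw : 0 < w.length) (i : ℕ) : α :=
  w[w.length - 1 - i % w.length]'(by omega)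

theorem periodicLetter_eq_iff (hw : 0 < w.length) (hnd : w.Nodup) (i j : ℕ) :
    periodicLetter w hw i = periodicLetter w hw j ↔ i ≡ j [MOD w.length] := by
  have hi := Nat.mod_lt i hw
  have hj := Nat.mod_lt j hw
  rw [periodicLetter, periodicLetter, hnd.getElem_inj_iff, Nat.ModEq]
  omega

theorem leftSuffix_periodicLetter_of_le (hw : 0 < w.length) {p : ℕ} (hp : p ≤ w.length) :
    leftSuffix (periodicLetter w hw) p = w.drop (w.length - p) := by
  induction p with
  | zero => simp [leftSuffix]
  | succ p ih =>
    rw [leftSuffix, ih (by omega), List.drop_eq_getElem_cons (i := w.length - (p + 1)) (by omega)]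
    congr 1
    · simp only [periodicLetter]
      congr 1
      rw [Nat.mod_eq_of_lt (by omega)]
      omega
    · congr 1
      omega

theorem leftSuffix_add_period {g : ℕ → α} {e : ℕ} (hg : ∀ i, g (i + e) = g i) (a : ℕ) :
    leftSuffix g (a + e) = leftSuffix g a ++ leftSuffix g e := by
  induction a with
  | zero => simp [leftSuffix]
  | succ a ih => rw [Nat.succ_add, leftSuffix, ih, hg, leftSuffix, List.cons_append]

theorem append_wordPow_eq_leftSuffix (hw : 0 < w.length) {w' : List α} (h : w' <:+ w) (k : ℕ) :
    w' ++ wordPow w k = leftSuffix (periodicLetter w hw) (w'.length + k * w.length) := by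
  induction k with
  | zero =>
    rw [Nat.zero_mul, Nat.add_zero, leftSuffix_periodicLetter_of_le hw h.length_le]
    simpa [wordPow] using List.suffix_iff_eq_drop.1 h
  | succ k ih =>
    have hper : ∀ i, periodicLetter w hw (i + w.length) = periodicLetter w hw i := fun i => by
      simp [periodicLetter]
    have hpow : wordPow w (k + 1) = wordPow w k ++ w := by
      simp [wordPow, List.replicate_succ']
    rw [Nat.succ_mul, ← Nat.add_assoc, leftSuffix_add_period hper, ← ih,
      leftSuffix_periodicLetter_of_le hw le_rfl, hpow]
    simp

end Periodic

/-! ### The size of the minimal automaton -/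

theorem mainTheorem2 {α : Type*} (w w₁ w₂ u v : List α) (k l : ℕ)
    (hlen : 2 ≤ w.length) (hw : w.Nodup)
    (hw₁ : w₁ <:+ w) (hw₁_ne : w₁ ≠ []) (hw₂ : w₂ <:+ w) (hw₂_ne : w₂ ≠ [])
    (hu : u = w₁ ++ wordPow w k) (hv : v = w₂ ++ wordPow w l) :
    (l < k →
      (∀ m : ℕ,
        IsGreatest {m : ℕ | m ≤ v.length ∧ ((u.length : ℤ) - m) % (w.length : ℤ) = 0} m →
        ∃ N : ℕ, MinimalDFASize (wordShuffle u v) N ∧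
          (N : ℚ) = (u.length + 1) * (v.length + 1) - 1 / 2 * v.length * (v.length + 1)
            - 1 / 2 * m * (m + 1)) ∧
      ((¬ ∃ m : ℕ, m ≤ v.length ∧ ((u.length : ℤ) - m) % (w.length : ℤ) = 0) →
        ∃ N : ℕ, MinimalDFASize (wordShuffle u v) N ∧
          (N : ℚ) = (u.length + 1) * (v.length + 1) - 1 / 2 * v.length * (v.length + 1))) ∧
    (k = l → w₂.length ≤ w₁.length →
      ∃ N : ℕ, MinimalDFASize (wordShuffle u v) N ∧
        (N : ℚ) = (u.length + 1) * (v.length + 1) - 1 / 2 * v.length * (v.length + 1)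
          - 1 / 2 * max ((u.length : ℚ) - w.length) 0
            * (max ((u.length : ℚ) - w.length) 0 + 1)) := by
  have hpos : 0 < w.length := by omega
  have hp := hw₁.length_le
  have hq := hw₂.length_le
  have hp₀ := List.length_pos_iff.2 hw₁_ne
  rw [append_wordPow_eq_leftSuffix hpos hw₁] at hu
  rw [append_wordPow_eq_leftSuffix hpos hw₂] at hv
  have hU : u.length = w₁.length + k * w.length := by rw [hu, length_leftSuffix]
  have hV : v.length = w₂.length + l * w.length := by rw [hv, length_leftSuffix]
  have key : ∀ D, v.length ≤ u.length →
      IsLeast {d | 0 < d ∧ w.length ∣ d ∧ u.length ≤ v.length + d} D →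
      ∃ N : ℕ, MinimalDFASize (wordShuffle u v) N ∧
        (N : ℚ) = (u.length + 1) * (v.length + 1) - 1 / 2 * v.length * (v.length + 1)
          - 1 / 2 * (u.length - D : ℕ) * ((u.length - D : ℕ) + 1) := by
    intro D hVU hD
    refine ⟨_, ?_, card_pairStates hVU hD.1.2.2⟩
    have h := minimalDFASize_suffixShuffle (periodicLetter_eq_iff hpos hw) hlen hVU hD
    rwa [suffixShuffle, hU, hV, ← hu, ← hv, ← hU, ← hV] at h
  -- The differences `U - m` with `m ≤ V` are the `d ≤ U` with `U ≤ V + d`.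
  have hmod : ∀ m, m ≤ u.length →
      (((u.length : ℤ) - m) % (w.length : ℤ) = 0 ↔ w.length ∣ u.length - m) := by
    intro m hm
    rw [← Int.natCast_dvd_natCast, Nat.cast_sub hm, Int.dvd_iff_emod_eq_zero]
  refine ⟨fun hlk => ?_, fun hkl hqp => ?_⟩
  · have hVU : v.length < u.length := by
      have := Nat.mul_le_mul_right w.length (Nat.succ_le_of_lt hlk)
      rw [Nat.succ_mul] at this
      omega
    constructor
    · rintro m ⟨⟨hmV, hm⟩, hmax⟩
      have hD := key (u.length - m) hVU.le
        ⟨⟨by omega, (hmod m (by omega)).1 hm, by omega⟩, fun d hd => ?_⟩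
      · rwa [Nat.sub_sub_self (by omega)] at hD
      · obtain ⟨hd₀, hnd, hUd⟩ := hd
        by_contra hlt
        have := hmax (show u.length - d ∈ _ from ⟨by omega, (hmod _ (by omega)).2
          (by rwa [Nat.sub_sub_self (by omega)])⟩)
        omega
    · intro hno
      have hex : ∃ d, 0 < d ∧ w.length ∣ d ∧ u.length ≤ v.length + d :=
        ⟨w.length * u.length, Nat.mul_pos hpos (by omega), Nat.dvd_mul_right _ _, by
          have := Nat.le_mul_of_pos_left u.length hpos
          omega⟩
      classical
      have hspec := Nat.find_spec hex
      have hD := key (Nat.find hex) hVU.le ⟨hspec, fun d hd => Nat.find_min' hex hd⟩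
      have hbig : u.length - Nat.find hex = 0 := by
        by_contra hne
        refine hno ⟨u.length - Nat.find hex, by omega, (hmod _ (by omega)).2 ?_⟩
        rw [Nat.sub_sub_self (by omega)]
        exact hspec.2.1
      simpa [hbig] using hD
  · subst hkl
    have hD := key w.length (by omega)
      ⟨⟨hpos, dvd_rfl, by omega⟩, fun d hd => Nat.le_of_dvd hd.1 hd.2.1⟩
    have hmax : ((u.length - w.length : ℕ) : ℚ) = max ((u.length : ℚ) - w.length) 0 := by
      obtain h | h := le_total w.length u.length
      · have : (w.length : ℚ) ≤ u.length := by exact_mod_cast h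
        rw [Nat.cast_sub h, max_eq_left (by linarith)]
      · have : (u.length : ℚ) ≤ w.length := by exact_mod_cast h
        rw [Nat.sub_eq_zero_of_le h, max_eq_right (by linarith), Nat.cast_zero]
    rwa [hmax] at hD
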